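/- **Kernel.** There are two cores $\kappa_0,\kappa_1$. A static configuration $conf$ consists of a bijection $c2s$ from cores to schedulers, a deployment $p2s(p)$ (a set of schedulers) for each partition $p$, an owner partition $p2p(po)$ for each port $po$, and, for each sampling channel $ch$, a source port $scsrc(ch)$ and a set $scdests(ch)$ of destination ports. A kernel state $s$ consists of the current partition $cur(\sigma)$ of each scheduler $\sigma$ and the content $schan(ch)$ (a message or empty) of the one-message buffer of each channel $ch$. An event has a guard on (parameters, core, state) and a body. The events on core $\kappa$ are: - $Core\_Init$: always enabled; its body is SKIP. - $Schedule$: no parameters, always enabled; its body sets $cur(c2s(\kappa))$ to a fixed, chosen partition $p$ with $c2s(\kappa)\in p2s(p)$ (Hilbert's choice). - $Write\_Sampling\_Message[po,m]$: enabled when $po$ is the source port of some channel and $p2p(po)=cur(c2s(\kappa))$; its body sets $schan(ch):=m$, where $ch$ is a fixed, chosen channel with source port $po$. - $Read\_Sampling\_Message[po]$: enabled when $po$ is a destination port of some channel and $p2p(po)=cur(c2s(\kappa))$; its body is SKIP. The parallel event system $XKernel$ runs on each core the event sequence $Core\_Init;\mathcal S$, where $\mathcal S$ is the event set of $Schedule$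 and of $Write\_Sampling\_Message\,[ps]$ and $Read\_Sampling\_Message\,[ps]$ for all concrete parameter lists $ps$. In an event set, an enabled event occurs, its body is executed, and then the event set is entered again. A configuration is a triple $(\sharp,s,x)$ of a parallel event system, a state, and an event context $x$ assigning to each core the event it currently executes. The small steps of the two cores are interleaved. A step on core $\kappa$ is either the occurrence of an event $ev$ (label $ev@\kappa$), which sets $x(\kappa):=ev$ and leaves the state unchanged, or an atomic program step of the body (label $c@\kappa$). There are no environment steps. **Security domains.** These are the partitions and the schedulers. The domain $dom\_e(s,\kappa,ev)$ is the current partition $cur_s(c2s(\kappa))$ if $ev$ is a write or read event, and the scheduler $c2s(\kappa)$ otherwise. The policy is: $d_1\leadsto d_2$ iff $d_1=d_2$, or $d_1$ is a scheduler and $d_2$ a partition deployed on it, or $d_1,d_2$ are partitions and some channel has its source port in $d_1$ and a destination port in $d_2$. The observation $ob(s,\sigma)$ of a scheduler $\sigma$ is $cur_s(\sigma)$; the observation $ob(s,p)$ of a partition $p$ is the content of all channels having a (source or destination) port owned by $p$. Each observation is encoded as a state that takes fixed values elsewhere. Put $s\sim_d t$ iff $ob(s,d)=ob(t,d)$, and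 lift $\sim_d$ and $ob$ to configurations. **State machine.** Fix an initial state $s_0$ and an initial event context $x_0$; the initial configuration is $\mathcal C_0=(XKernel,s_0,x_0)$. An action is a triple $a=\langle\delta_a,ev_a,d_a\rangle$ of a label, an event and a domain. $(\mathcal C,\mathcal C')\in step(a)$ iff $\mathcal C\to\mathcal C'$ is a step with label $\delta_a$ on some core $\kappa$, where $\delta_a=ev_a@\kappa$, or $\delta_a=c@\kappa$ and $ev_a=x_{\mathcal C}(\kappa)$, and where $d_a=dom\_e(s_{\mathcal C},\kappa,ev_a)$. Let $run(as)$ be the composition of $step(a)$ along the action list $as$; $\mathcal R(\mathcal C)$ means $(\mathcal C_0,\mathcal C)\in run(as)$ for some $as$. Define $sources([\,],d)=\{d\}$ and $$sources(a\#as,d)=sources(as,d)\cup\{d_a\mid \exists v\in sources(as,d),\ d_a\leadsto v\}.$$ The list $ipurge(as,d)$ is obtained by setting $ipurge([\,],d)=[\,]$ and $ipurge(a\#as,d)=a\#ipurge(as,d)$ if $d_a\in sources(a\#as,d)$, and $ipurge(a\#as,d)=ipurge(as,d)$ otherwise. **Theorem.** For every configuration $conf$, initial state $s_0$ and initial event context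 $x_0$, $XKernel$ satisfies *noninfluence* and *nonleakage*. That is, for all $\mathcal C_1,\mathcal C_2$ with $\mathcal R(\mathcal C_1)$ and $\mathcal R(\mathcal C_2)$, every domain $d$, and every action list $as$ such that $\mathcal C_1\sim_u\mathcal C_2$ for all $u\in sources(as,d)$: - (noninfluence) if $(\mathcal C_1,\mathcal C_1')\in run(as)$ and $(\mathcal C_2,\mathcal C_2')\in run(ipurge(as,d))$, then $ob(\mathcal C_1',d)=ob(\mathcal C_2',d)$; - (nonleakage) if $(\mathcal C_1,\mathcal C_1')\in run(as)$ and $(\mathcal C_2,\mathcal C_2')\in run(as)$, then $ob(\mathcal C_1',d)=ob(\mathcal C_2',d)$. -/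

import Mathlib

universe u

namespace EventIFS

/-! ### The event language: abstract syntax -/

/-- Programs over the state space `S`. -/
inductive Prog (S : Type*) where
  | basic (f : S → S) : Prog S
  | seq (P₁ P₂ : Prog S) : Prog S
  | cond (b : Set S) (P₁ P₂ : Prog S) : Prog S
  | while (b : Set S) (P : Prog S) : Prog S
  | await (b : Set S) (P : Prog S) : Prog S
  | nondt (r : Set (S × S)) : Prog S

/-- The program `SKIP`. -/
def Prog.skip {S : Type*} : Prog S := .basic id

/-- Event specifications: they map parameters `p` and the label `κ` of an event system to a guard
condition and a program, the body of the event. -/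
abbrev EventSpec (S Par K : Type*) := Par × K → Set S × Prog S

/-- Events: basic events `EVENT α`, and anonymous events, which wrap a (possibly finished,
`none`) program. -/
inductive Event (S Par K : Type*) where
  | basic (α : EventSpec S Par K) : Event S Par K
  | anon (P : Option (Prog S)) : Event S Par K

/-- Event systems: event sets and event sequences `E ; ES`. -/
inductive EvtSys (S Par K : Type*) where
  | evtSet (Es : Set (Event S Par K)) : EvtSys S Par K
  | evtSeq (E : Event S Par K) (ES : EvtSys S Par K) : EvtSys S Par K

/-- Parallel event systems. -/
abbrev ParSys (S Par K : Type*) := K → EvtSys S Par K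

/-- Event contexts: the event currently executed in each event system. -/
abbrev EvtCtx (S Par K : Type*) := K → Event S Par K

/-! ### Operational semantics -/

mutual

/-- One atomic step `(P, s) → (P', s')` of a program; the result `none` is the finished program.
Program steps never read or modify the event context, which is therefore left out here. -/
inductive ProgStep {S : Type u} : Prog S → S → Option (Prog S) → S → Prop where
  | basic (f : S → S) (s : S) : ProgStep (.basic f) s none (f s)
  | seq1 {P₁ P₂ : Prog S} {s s' : S} :
      ProgStep P₁ s none s' → ProgStep (.seq P₁ P₂) s (some P₂) s'
  | seq2 {P₁ P₁' P₂ : Prog S} {s s' : S} :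
      ProgStep P₁ s (some P₁') s' → ProgStep (.seq P₁ P₂) s (some (.seq P₁' P₂)) s'
  | condT {b : Set S} {P₁ P₂ : Prog S} {s : S} :
      s ∈ b → ProgStep (.cond b P₁ P₂) s (some P₁) s
  | condF {b : Set S} {P₁ P₂ : Prog S} {s : S} :
      s ∉ b → ProgStep (.cond b P₁ P₂) s (some P₂) s
  | whileF {b : Set S} {P : Prog S} {s : S} :
      s ∉ b → ProgStep (.while b P) s none s
  | whileT {b : Set S} {P : Prog S} {s : S} :
      s ∈ b → ProgStep (.while b P) s (some (.seq P (.while b P))) s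
  | await {b : Set S} {P : Prog S} {s s' : S} :
      s ∈ b → ProgSteps (some P) s none s' → ProgStep (.await b P) s none s'
  | nondt {r : Set (S × S)} {s s' : S} :
      (s, s') ∈ r → ProgStep (.nondt r) s none s'

/-- The reflexive transitive closure of `ProgStep`. -/
inductive ProgSteps {S : Type u} : Option (Prog S) → S → Option (Prog S) → S → Prop where
  | refl (Q : Option (Prog S)) (s : S) : ProgSteps Q s Q s
  | head {P : Prog S} {Q R : Option (Prog S)} {s s' s'' : S} :
      ProgStep P s Q s' → ProgSteps Q s' R s'' → ProgSteps (some P) s R s''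

end

/-- Kinds of transitions: a program action `c`, or the occurrence of an event. -/
inductive ActKind (S Par K : Type*) where
  | cmd : ActKind S Par K
  | occ (E : Event S Par K) : ActKind S Par K

/-- A transition label `t@κ`. -/
structure Label (S Par K : Type*) where
  kind : ActKind S Par K
  core : K

section Semantics

variable {S Par K : Type*} [DecidableEq K]

/-- Transitions of events. -/
inductive EventStep : Event S Par K → S → EvtCtx S Par K → Label S Par K →
    Event S Par K → S → EvtCtx S Par K → Prop where
  | anonyEvt {P : Prog S} {P' : Option (Prog S)} {s s' : S} {x : EvtCtx S Par K} {κ : K} :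
      ProgStep P s P' s' →
      EventStep (.anon (some P)) s x ⟨.cmd, κ⟩ (.anon P') s' x
  | basicEvt {α : EventSpec S Par K} {p : Par} {κ : K} {s : S} {x : EvtCtx S Par K} :
      s ∈ (α (p, κ)).1 →
      EventStep (.basic α) s x ⟨.occ (.basic α), κ⟩
        (.anon (some (α (p, κ)).2)) s (Function.update x κ (.basic α))

/-- Transitions of event systems. -/
inductive EvtSysStep : EvtSys S Par K → S → EvtCtx S Par K → Label S Par K →
    EvtSys S Par K → S → EvtCtx S Par K → Prop where
  | evtSet {Es : Set (Event S Par K)} {E E' : Event S Par K} {s : S} {x x' : EvtCtx S Par K}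
      {κ : K} :
      E ∈ Es → EventStep E s x ⟨.occ E, κ⟩ E' s x' →
      EvtSysStep (.evtSet Es) s x ⟨.occ E, κ⟩ (.evtSeq E' (.evtSet Es)) s x'
  | evtSeq1 {E E' : Event S Par K} {ES : EvtSys S Par K} {s s' : S} {x x' : EvtCtx S Par K}
      {δ : Label S Par K} :
      EventStep E s x δ E' s' x' →
      EvtSysStep (.evtSeq E ES) s x δ (.evtSeq E' ES) s' x'
  | evtSeq2 {E : Event S Par K} {ES : EvtSys S Par K} {s s' : S} {x x' : EvtCtx S Par K}
      {δ : Label S Par K} :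
      EventStep E s x δ (.anon none) s' x' →
      EvtSysStep (.evtSeq E ES) s x δ ES s' x'

end Semantics

/-- Configurations of parallel event systems. -/
structure PConf (S Par K : Type*) where
  spec : ParSys S Par K
  state : S
  ctx : EvtCtx S Par K

/-- Action transitions of parallel event systems: interleaving of the steps of the event
systems. -/
inductive ParStep {S Par K : Type*} [DecidableEq K] :
    PConf S Par K → Label S Par K → PConf S Par K → Prop where
  | par {PS : ParSys S Par K} {s s' : S} {x x' : EvtCtx S Par K} {t : ActKind S Par K} {κ : K}
      {ES' : EvtSys S Par K} :
      EvtSysStep (PS κ) s x ⟨t, κ⟩ ES' s' x' →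
      ParStep ⟨PS, s, x⟩ ⟨t, κ⟩ ⟨Function.update PS κ ES', s', x'⟩

/-! ### Information-flow security -/

/-- The data of a security analysis: the dynamic execution domain of events, the reflexive
interference policy, the equivalence relations of the domains on states, and the observation
function. -/
structure IFSConfig (S Par K D O : Type*) where
  domE : S → K → Event S Par K → D
  interf : D → D → Prop
  interf_refl : ∀ d, interf d d
  equiv : D → S → S → Prop
  equiv_equivalence : ∀ d, Equivalence (equiv d)
  ob : S → D → O

/-- Actions `⟨δ, ev, d⟩` of the state machine. -/
structure Action (S Par K D : Type*) where
  label : Label S Par K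
  ev : Event S Par K
  dom : D

/-- A nondeterministic state machine with configurations `Δ` and actions `A`. -/
structure StateMachine (Δ A : Type*) where
  step : A → Set (Δ × Δ)
  init : Δ

namespace StateMachine

variable {Δ A : Type*} (M : StateMachine Δ A)

/-- Execution of a sequence of actions, from left to right. -/
def run : List A → Set (Δ × Δ)
  | [] => {c | c.1 = c.2}
  | a :: as => {c | ∃ C, (c.1, C) ∈ M.step a ∧ (C, c.2) ∈ run as}

/-- The set of final configurations of the executions of `as` from `C`. -/
def execution (C : Δ) (as : List A) : Set Δ := {C' | (C, C') ∈ M.run as}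

/-- Reachability from the initial configuration. -/
def Reachable (C : Δ) : Prop := ∃ as, (M.init, C) ∈ M.run as

end StateMachine

section IFS

variable {S Par K D O : Type*} [DecidableEq K] (I : IFSConfig S Par K D O)

/-- The state machine of the closed parallel event system `PS` started in the state `s₀` and the
event context `x₀`. -/
def machine (PS : ParSys S Par K) (s₀ : S) (x₀ : EvtCtx S Par K) :
    StateMachine (PConf S Par K) (Action S Par K D) where
  step a := {c | ParStep c.1 a.label c.2 ∧
    ((a.label.kind = .occ a.ev ∧ I.domE c.1.state a.label.core a.ev = a.dom) ∨
     (a.label.kind = .cmd ∧ a.ev = c.1.ctx a.label.core ∧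
        I.domE c.1.state a.label.core a.ev = a.dom))}
  init := ⟨PS, s₀, x₀⟩

/-- The domains that are allowed to pass information to `d` while the actions execute. -/
def sources : List (Action S Par K D) → D → Set D
  | [], d => {d}
  | a :: as, d => sources as d ∪ {w | w = a.dom ∧ ∃ v, I.interf w v ∧ v ∈ sources as d}

open Classical in
/-- The intransitive purged sequence. -/
noncomputable def ipurge : List (Action S Par K D) → D → List (Action S Par K D)
  | [], _ => []
  | a :: as, d => if a.dom ∈ sources I (a :: as) d then a :: ipurge as d else ipurge as d

/-- Equivalence of configurations for all domains in a set. -/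
def EquivOn (Ds : Set D) (C₁ C₂ : PConf S Par K) : Prop :=
  ∀ d ∈ Ds, I.equiv d C₁.state C₂.state

/-- Observational equivalence of two sets of configurations for the domain `d`. -/
def ObsEquiv (d : D) (Cs₁ Cs₂ : Set (PConf S Par K)) : Prop :=
  ∀ C₁ C₂, C₁ ∈ Cs₁ ∧ C₂ ∈ Cs₂ → I.ob C₁.state d = I.ob C₂.state d

/-- Nonleakage of the state machine of `PS` started in `s₀`, `x₀`. -/
def Nonleakage (PS : ParSys S Par K) (s₀ : S) (x₀ : EvtCtx S Par K) : Prop :=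
  let M := machine I PS s₀ x₀
  ∀ (C₁ C₂ : PConf S Par K) (d : D) (as : List (Action S Par K D)),
    M.Reachable C₁ ∧ M.Reachable C₂ → EquivOn I (sources I as d) C₁ C₂ →
      ObsEquiv I d (M.execution C₁ as) (M.execution C₂ as)

/-- Noninfluence of the state machine of `PS` started in `s₀`, `x₀`. -/
def Noninfluence (PS : ParSys S Par K) (s₀ : S) (x₀ : EvtCtx S Par K) : Prop :=
  let M := machine I PS s₀ x₀
  ∀ (C₁ C₂ : PConf S Par K) (d : D) (as : List (Action S Par K D)),
    M.Reachable C₁ ∧ M.Reachable C₂ → EquivOn I (sources I as d) C₁ C₂ →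
      ObsEquiv I d (M.execution C₁ as) (M.execution C₂ (ipurge I as d))

end IFS

/-! ### The two-core ARINC 653 separation kernel -/

/-- The two processor cores `κ₀` and `κ₁`. -/
abbrev Core := Fin 2

/-- Static kernel configurations; `c2s` is the bijection from cores to schedulers, `p2s` the
deployment of partitions to schedulers, `p2p` the partition owning a port, `scsrc` and `scdests`
the source port and the destination ports of a sampling channel. -/
structure Config (Sched Part Port Chan : Type*) where
  c2s : Core → Sched
  c2s_bijective : Function.Bijective c2s
  p2s : Part → Set Sched
  p2p : Port → Part
  scsrc : Chan → Port
  scdests : Chan → Set Port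

/-- Kernel states: the current partition of each scheduler and the one-message buffer of each
channel. -/
structure KState (Sched Part Chan Msg : Type*) where
  cur : Sched → Part
  schan : Chan → Option Msg

/-- Values that are passed as event parameters. -/
inductive Param (Port Msg : Type*) where
  | port (po : Port) : Param Port Msg
  | msg (m : Msg) : Param Port Msg

/-- Security domains: partitions and schedulers. -/
inductive Domain (Sched Part : Type*) where
  | P (p : Part) : Domain Sched Part
  | S (s : Sched) : Domain Sched Part

section Kernel

variable {Sched Part Port Chan Msg : Type*} (conf : Config Sched Part Port Chan)

/-- Event specifications of the kernel; the parameters are lists of ports and messages. -/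
abbrev KSpec (Sched Part Port Chan Msg : Type*) :=
  EventSpec (KState Sched Part Chan Msg) (List (Param Port Msg)) Core

/-- Events of the kernel. -/
abbrev KEvent (Sched Part Port Chan Msg : Type*) :=
  Event (KState Sched Part Chan Msg) (List (Param Port Msg)) Core

/-- `po` is the source port of some channel. -/
def IsSrcSampPort (po : Port) : Prop := ∃ ch, conf.scsrc ch = po

/-- `po` is a destination port of some channel. -/
def IsDestSampPort (po : Port) : Prop := ∃ ch, po ∈ conf.scdests ch

/-- The channel of which `po` is the source port. -/
noncomputable def chSrcSampPort (po : Port) (h : IsSrcSampPort conf po) : Chan := h.choose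

/-- A fixed partition (Hilbert's choice) deployed on the scheduler `d`; the current partition of
`d` only witnesses that there is a partition at all. -/
noncomputable def chosenPart (d : Sched) (s : KState Sched Part Chan Msg) : Part :=
  @Classical.epsilon Part ⟨s.cur d⟩ fun p => d ∈ conf.p2s p

open Classical in
/-- The state change of `Schedule` on core `κ`: the chosen partition becomes the current partition
of the scheduler of `κ`. -/
noncomputable def scheduleUpd (κ : Core) (s : KState Sched Part Chan Msg) :
    KState Sched Part Chan Msg :=
  { s with cur := Function.update s.cur (conf.c2s κ) (chosenPart conf (conf.c2s κ) s) }

open Classical in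
/-- The state change of `Write_Sampling_Message`: store `m` in the channel with source port
`po`. -/
noncomputable def writeUpd (po : Port) (m : Msg) (s : KState Sched Part Chan Msg) :
    KState Sched Part Chan Msg :=
  if h : IsSrcSampPort conf po then
    { s with schan := Function.update s.schan (chSrcSampPort conf po h) (some m) }
  else s

/-- `Core_Init`: always enabled, does nothing. -/
def coreInit : KSpec Sched Part Port Chan Msg := fun _ => (Set.univ, .skip)

/-- `Schedule`: takes no parameters, schedules a partition on the executing core. -/
noncomputable def schedule : KSpec Sched Part Port Chan Msg := fun
  | ([], κ) => (Set.univ, .basic (scheduleUpd conf κ))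
  | (_, _) => (∅, .skip)

/-- `Write_Sampling_Message`: takes a source port of the current partition and a message. -/
noncomputable def writeSamplingMessage : KSpec Sched Part Port Chan Msg := fun
  | ([.port po, .msg m], κ) =>
      ({s | IsSrcSampPort conf po ∧ conf.p2p po = s.cur (conf.c2s κ)}, .basic (writeUpd conf po m))
  | (_, _) => (∅, .skip)

/-- `Read_Sampling_Message`: takes a destination port of the current partition, does not change
the state. -/
def readSamplingMessage : KSpec Sched Part Port Chan Msg := fun
  | ([.port po], κ) =>
      ({s | IsDestSampPort conf po ∧ conf.p2p po = s.cur (conf.c2s κ)}, .skip)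
  | (_, _) => (∅, .skip)

/-- The event `α ps`: the parametrized event `α` restricted to the concrete parameters `ps`. -/
def EventSpec.inst {S Par K : Type*} (α : EventSpec S Par K) (ps : Par) : Event S Par K :=
  .basic fun q => ({s | q.1 = ps ∧ s ∈ (α q).1}, (α q).2)

/-- The kernel: each core runs `Core_Init` followed by the event set of `Schedule`,
`Write_Sampling_Message ps` and `Read_Sampling_Message ps` for all parameters `ps`. -/
noncomputable def XKernel :
    ParSys (KState Sched Part Chan Msg) (List (Param Port Msg)) Core := fun _ =>
  .evtSeq (.basic coreInit) (.evtSet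
    ({.basic (schedule conf)} ∪ Set.range (writeSamplingMessage conf).inst ∪
      Set.range (readSamplingMessage conf).inst))

open Classical in
/-- The domain of an event: the current partition of the executing core for the write and read
events, the scheduler of the executing core for all others. -/
noncomputable def domOfEvt (s : KState Sched Part Chan Msg) (κ : Core)
    (e : KEvent Sched Part Port Chan Msg) : Domain Sched Part :=
  if (∃ ps, e = (writeSamplingMessage conf).inst ps) ∨
      (∃ ps, e = (readSamplingMessage conf).inst ps) then
    .P (s.cur (conf.c2s κ))
  else .S (conf.c2s κ)

/-- `d₁` is a partition deployed on the scheduler `d₂`. -/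
def partOnCore : Domain Sched Part → Domain Sched Part → Prop
  | .P p, .S s => s ∈ conf.p2s p
  | _, _ => False

/-- There is a channel from the partition `d₁` to the partition `d₂`. -/
def chConn2 : Domain Sched Part → Domain Sched Part → Prop
  | .P p₁, .P p₂ => ∃ ch, conf.p2p (conf.scsrc ch) = p₁ ∧ ∃ po ∈ conf.scdests ch, conf.p2p po = p₂
  | _, _ => False

/-- The interference policy of the kernel. -/
def kInterf (d₁ d₂ : Domain Sched Part) : Prop :=
  d₁ = d₂ ∨ partOnCore conf d₂ d₁ ∨ chConn2 conf d₁ d₂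

/-- Some port of the partition `p` is connected with the channel `ch`. -/
def PartConnected (p : Part) (ch : Chan) : Prop :=
  ∃ po, (po = conf.scsrc ch ∨ po ∈ conf.scdests ch) ∧ conf.p2p po = p

open Classical in
/-- The messages of the channels connected with the partition `p`. -/
noncomputable def schanObsPart (s : KState Sched Part Chan Msg) (p : Part) : Chan → Option Msg :=
  fun ch => if PartConnected conf p ch then s.schan ch else none

open Classical in
/-- The observation of a domain, as a state that agrees with the initial state `s₀` in all
components the domain does not see. -/
noncomputable def stateObs (s₀ s : KState Sched Part Chan Msg) :
    Domain Sched Part → KState Sched Part Chan Msg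
  | .P p => { s₀ with schan := schanObsPart conf s p }
  | .S d => { s₀ with cur := Function.update s₀.cur d (s.cur d) }

/-- The security configuration of the kernel with the initial state `s₀`. -/
noncomputable def kernelIFS (s₀ : KState Sched Part Chan Msg) :
    IFSConfig (KState Sched Part Chan Msg) (List (Param Port Msg)) Core (Domain Sched Part)
      (KState Sched Part Chan Msg) where
  domE := domOfEvt conf
  interf := kInterf conf
  interf_refl _ := Or.inl rfl
  equiv d s t := stateObs conf s₀ s d = stateObs conf s₀ t d
  equiv_equivalence _ := ⟨fun _ => rfl, fun h => h.symm, fun h h' => h.trans h'⟩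
  ob := stateObs conf s₀

end Kernel

end EventIFS

-- The proof is by unwinding: both security properties follow by induction on the action list from
-- two conditions on single steps, required only at configurations satisfying an invariant.
--
-- Step consistency holds in a strong form: a step common to two configurations preserves the
-- equivalence of each domain separately, with no assumption about the acting domain. The reason is
-- that nothing a body stores is read from the state: a write stores a message fixed by the event,
-- and `Schedule` installs a partition chosen independently of the state. What must be shown is that
-- an action determines its body. It records the event, the event carries its concrete parameters,
-- and these fix the body (`Running.unique`).
--
-- Local respect is a matter of visibility. `Schedule` changes only the current partition of its own
-- scheduler, which no other domain observes. A write changes one channel, seen only by the owner of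
-- its source port and by the owners of its destination ports, and the policy lets the writer
-- interfere with all of these.
--
-- The delicate point is that guard and body are separate steps, with steps of the other core
-- possibly in between, while the domain of a program action is computed when the body runs. The
-- invariant `KernelInv` therefore records that the guard of a running event still holds. It
-- survives interleaving because guards read only the current partition of the own scheduler, and
-- `c2s` is injective, so the other core cannot change it (`Running.cur_eq`, `KernelInv.parStep`).

namespace EventIFS

/-! ### Unwinding -/

section Unwinding

variable {S Par K D O : Type*} (I : IFSConfig S Par K D O)
  {PS : ParSys S Par K} {s₀ : S} {x₀ : EvtCtx S Par K}

/-- `Inv` is preserved by the steps of a state machine. -/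
def StateMachine.Preserves {Δ A : Type*} (M : StateMachine Δ A) (Inv : Δ → Prop) : Prop :=
  ∀ a C C', Inv C → (C, C') ∈ M.step a → Inv C'

theorem StateMachine.Preserves.run {Δ A : Type*} {M : StateMachine Δ A} {Inv : Δ → Prop}
    (h : M.Preserves Inv) (as : List A) {C C' : Δ} (hC : Inv C) (hr : (C, C') ∈ M.run as) :
    Inv C' := by
  induction as generalizing C with
  | nil => exact (show C = C' from hr) ▸ hC
  | cons a as ih =>
    obtain ⟨C₁, h₁, h₂⟩ := hr
    exact ih (h a C C₁ hC h₁) h₂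

/-- Local respect: the steps of an action are invisible to the domains that the domain of the
action does not interfere with. -/
def LocalRespect (M : StateMachine (PConf S Par K) (Action S Par K D))
    (Inv : PConf S Par K → Prop) : Prop :=
  ∀ a C C' u, Inv C → (C, C') ∈ M.step a → ¬ I.interf a.dom u → I.equiv u C.state C'.state

/-- Step consistency: the steps of an action preserve the equivalence of every domain. -/
def StepConsistent (M : StateMachine (PConf S Par K) (Action S Par K D))
    (Inv : PConf S Par K → Prop) : Prop :=
  ∀ a C₁ C₁' C₂ C₂' u, Inv C₁ → Inv C₂ → (C₁, C₁') ∈ M.step a → (C₂, C₂') ∈ M.step a →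
    I.equiv u C₁.state C₂.state → I.equiv u C₁'.state C₂'.state

variable {I} {M : StateMachine (PConf S Par K) (Action S Par K D)} {Inv : PConf S Par K → Prop}

/-- The sources of a tail are among the sources of the whole list, so the equivalences needed for
the tail are available before the first action and step consistency carries them across it. -/
theorem StepConsistent.equiv_run (hp : M.Preserves Inv) (hs : StepConsistent I M Inv)
    (as : List (Action S Par K D)) {d : D} {C₁ C₂ C₁' C₂' : PConf S Par K}
    (h₁ : Inv C₁) (h₂ : Inv C₂) (he : EquivOn I (sources I as d) C₁ C₂)
    (hr₁ : (C₁, C₁') ∈ M.run as) (hr₂ : (C₂, C₂') ∈ M.run as) :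
    I.equiv d C₁'.state C₂'.state := by
  induction as generalizing C₁ C₂ with
  | nil =>
    obtain rfl : C₁ = C₁' := hr₁
    obtain rfl : C₂ = C₂' := hr₂
    exact he d rfl
  | cons a as ih =>
    obtain ⟨E₁, ha₁, hr₁⟩ := hr₁
    obtain ⟨E₂, ha₂, hr₂⟩ := hr₂
    exact ih (hp _ _ _ h₁ ha₁) (hp _ _ _ h₂ ha₂)
      (fun u hu => hs a _ _ _ _ u h₁ h₂ ha₁ ha₂ (he u (Or.inl hu))) hr₁ hr₂

theorem StepConsistent.equiv_run_ipurge (hp : M.Preserves Inv) (hs : StepConsistent I M Inv)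
    (hl : LocalRespect I M Inv) (as : List (Action S Par K D)) {d : D}
    {C₁ C₂ C₁' C₂' : PConf S Par K} (h₁ : Inv C₁) (h₂ : Inv C₂)
    (he : EquivOn I (sources I as d) C₁ C₂)
    (hr₁ : (C₁, C₁') ∈ M.run as) (hr₂ : (C₂, C₂') ∈ M.run (ipurge I as d)) :
    I.equiv d C₁'.state C₂'.state := by
  induction as generalizing C₁ C₂ with
  | nil =>
    obtain rfl : C₁ = C₁' := hr₁
    obtain rfl : C₂ = C₂' := hr₂
    exact he d rfl
  | cons a as ih =>
    obtain ⟨E₁, ha₁, hr₁⟩ := hr₁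
    by_cases hd : a.dom ∈ sources I (a :: as) d
    · rw [ipurge, if_pos hd] at hr₂
      obtain ⟨E₂, ha₂, hr₂⟩ := hr₂
      exact ih (hp _ _ _ h₁ ha₁) (hp _ _ _ h₂ ha₂)
        (fun u hu => hs a _ _ _ _ u h₁ h₂ ha₁ ha₂ (he u (Or.inl hu))) hr₁ hr₂
    · rw [ipurge, if_neg hd] at hr₂
      -- A purged action moves only the first run. Its domain interferes with no source of the tail,
      -- so local respect restores the equivalence with the unmoved `C₂`.
      refine ih (hp _ _ _ h₁ ha₁) h₂ (fun u hu => ?_) hr₁ hr₂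
      have hi : ¬ I.interf a.dom u := fun hi => hd (Or.inr ⟨rfl, u, hi, hu⟩)
      exact (I.equiv_equivalence u).trans
        ((I.equiv_equivalence u).symm (hl a _ _ u h₁ ha₁ hi)) (he u (Or.inl hu))

variable [DecidableEq K]

theorem nonleakage_of_unwinding (hob : ∀ d s t, I.equiv d s t → I.ob s d = I.ob t d)
    (h₀ : Inv ⟨PS, s₀, x₀⟩) (hp : (machine I PS s₀ x₀).Preserves Inv)
    (hs : StepConsistent I (machine I PS s₀ x₀) Inv) : Nonleakage I PS s₀ x₀ := by
  rintro C₁ C₂ d as ⟨⟨as₁, hr₁⟩, as₂, hr₂⟩ he C₁' C₂' ⟨h₁, h₂⟩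
  exact hob _ _ _ (hs.equiv_run hp as (hp.run as₁ h₀ hr₁) (hp.run as₂ h₀ hr₂) he h₁ h₂)

theorem noninfluence_of_unwinding (hob : ∀ d s t, I.equiv d s t → I.ob s d = I.ob t d)
    (h₀ : Inv ⟨PS, s₀, x₀⟩) (hp : (machine I PS s₀ x₀).Preserves Inv)
    (hs : StepConsistent I (machine I PS s₀ x₀) Inv)
    (hl : LocalRespect I (machine I PS s₀ x₀) Inv) : Noninfluence I PS s₀ x₀ := by
  rintro C₁ C₂ d as ⟨⟨as₁, hr₁⟩, as₂, hr₂⟩ he C₁' C₂' ⟨h₁, h₂⟩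
  exact hob _ _ _ (hs.equiv_run_ipurge hp hl as (hp.run as₁ h₀ hr₁) (hp.run as₂ h₀ hr₂) he h₁ h₂)

end Unwinding

/-! ### Events of the kernel -/

section KernelProofs

variable {Sched Part Port Chan Msg : Type*} (conf : Config Sched Part Port Chan)

/-- In the state `s`, core `κ` executes the event `e`, whose body performs the state change `f`. -/
inductive Running (κ : Core) (s : KState Sched Part Chan Msg) :
    KEvent Sched Part Port Chan Msg → (KState Sched Part Chan Msg → KState Sched Part Chan Msg) →
      Prop where
  | init : Running κ s (.basic coreInit) id
  | schedule : Running κ s (.basic (schedule conf)) (scheduleUpd conf κ)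
  | write {po : Port} {m : Msg} : IsSrcSampPort conf po → conf.p2p po = s.cur (conf.c2s κ) →
      Running κ s ((writeSamplingMessage conf).inst [.port po, .msg m]) (writeUpd conf po m)
  | read {po : Port} : IsDestSampPort conf po → conf.p2p po = s.cur (conf.c2s κ) →
      Running κ s ((readSamplingMessage conf).inst [.port po]) id

/-- The event set of the kernel. -/
noncomputable def kernelSet : EvtSys (KState Sched Part Chan Msg) (List (Param Port Msg)) Core :=
  .evtSet ({.basic (schedule conf)} ∪ Set.range (writeSamplingMessage conf).inst ∪
    Set.range (readSamplingMessage conf).inst)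

/-- The possible local configurations of a core during the execution of the kernel. -/
inductive CoreInv (κ : Core) (s : KState Sched Part Chan Msg)
    (e : KEvent Sched Part Port Chan Msg) :
    EvtSys (KState Sched Part Chan Msg) (List (Param Port Msg)) Core → Prop where
  | start : CoreInv κ s e (.evtSeq (.basic coreInit) (kernelSet conf))
  | idle : CoreInv κ s e (kernelSet conf)
  | done : CoreInv κ s e (.evtSeq (.anon none) (kernelSet conf))
  | running {f : KState Sched Part Chan Msg → KState Sched Part Chan Msg} :
      Running conf κ s e f →
      CoreInv κ s e (.evtSeq (.anon (some (.basic f))) (kernelSet conf))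

/-- The invariant of the kernel. -/
def KernelInv (C : PConf (KState Sched Part Chan Msg) (List (Param Port Msg)) Core) : Prop :=
  ∀ κ, CoreInv conf κ C.state (C.ctx κ) (C.spec κ)

-- Preservation of the kernel invariant

variable {conf}

/-- Guards depend on the state only through the current partition of the executing core's scheduler.
-/
theorem Running.congr_cur {κ : Core} {s t : KState Sched Part Chan Msg}
    {e : KEvent Sched Part Port Chan Msg} {f}
    (h : Running conf κ s e f) (hc : t.cur (conf.c2s κ) = s.cur (conf.c2s κ)) :
    Running conf κ t e f := by
  cases h with
  | init => exact .init
  | schedule => exact .schedule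
  | write h₁ h₂ => exact .write h₁ (h₂.trans hc.symm)
  | read h₁ h₂ => exact .read h₁ (h₂.trans hc.symm)

theorem CoreInv.congr_cur {κ : Core} {s t : KState Sched Part Chan Msg}
    {e : KEvent Sched Part Port Chan Msg} {ES}
    (h : CoreInv conf κ s e ES) (hc : t.cur (conf.c2s κ) = s.cur (conf.c2s κ)) :
    CoreInv conf κ t e ES := by
  cases h with
  | start => exact .start
  | idle => exact .idle
  | done => exact .done
  | running h => exact .running (h.congr_cur hc)

/-- The body of a running event only changes the current partition of the executing core. -/
theorem Running.cur_eq {κ κ' : Core} {s t : KState Sched Part Chan Msg}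
    {e : KEvent Sched Part Port Chan Msg} {f} (h : Running conf κ s e f) (hne : κ' ≠ κ) :
    (f t).cur (conf.c2s κ') = t.cur (conf.c2s κ') := by
  cases h with
  | init => rfl
  | schedule =>
    have hs : conf.c2s κ' ≠ conf.c2s κ := fun h => hne (conf.c2s_bijective.1 h)
    simp [scheduleUpd, hs]
  | write h₁ _ => simp [writeUpd, h₁]
  | read => rfl

theorem progStep_basic {S : Type u} {f : S → S} {s s' : S} {Q : Option (Prog S)}
    (h : ProgStep (.basic f) s Q s') : Q = none ∧ s' = f s := by
  cases h
  exact ⟨rfl, rfl⟩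

/-- A guard of an event in the event set of the kernel, together with the body it admits. -/
theorem Running.of_mem_guard {κ : Core} {s : KState Sched Part Chan Msg}
    {α : KSpec Sched Part Port Chan Msg} {p : List (Param Port Msg)}
    (hα : Event.basic α ∈ ({.basic (EventIFS.schedule conf)} ∪
      Set.range (writeSamplingMessage conf).inst ∪
      Set.range (readSamplingMessage conf).inst : Set (KEvent Sched Part Port Chan Msg)))
    (hs : s ∈ (α (p, κ)).1) :
    ∃ f, (α (p, κ)).2 = .basic f ∧ Running conf κ s (.basic α) f := by
  rcases hα with (hα | ⟨ps, hα⟩) | ⟨ps, hα⟩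
  · obtain rfl : α = EventIFS.schedule conf := by simpa using hα
    -- `Schedule` has an empty guard on every nonempty parameter list.
    match p, hs with
    | [], _ => exact ⟨_, rfl, .schedule⟩
  · simp only [EventSpec.inst, Event.basic.injEq] at hα
    subst hα
    obtain ⟨rfl, hs⟩ := hs
    match p, hs with
    | [.port po, .msg m], hs => exact ⟨_, rfl, .write hs.1 hs.2⟩
  · simp only [EventSpec.inst, Event.basic.injEq] at hα
    subst hα
    obtain ⟨rfl, hs⟩ := hs
    match p, hs with
    | [.port po], hs => exact ⟨_, rfl, .read hs.1 hs.2⟩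

/-- The steps of one core of the kernel: either an event occurs and the state is unchanged, or
the body of the current event is executed. -/
theorem CoreInv.step {κ : Core} {s s' : KState Sched Part Chan Msg}
    {x x' : EvtCtx (KState Sched Part Chan Msg) (List (Param Port Msg)) Core} {ES ES'}
    {t : ActKind (KState Sched Part Chan Msg) (List (Param Port Msg)) Core}
    (h : CoreInv conf κ s (x κ) ES) (hst : EvtSysStep ES s x ⟨t, κ⟩ ES' s' x') :
    CoreInv conf κ s' (x' κ) ES' ∧ (∀ κ' ≠ κ, x' κ' = x κ') ∧
      ((t ≠ .cmd ∧ s' = s) ∨ (t = .cmd ∧ ∃ f, Running conf κ s (x κ) f ∧ s' = f s)) := by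
  cases h with
  | start =>
    cases hst with
    | evtSeq1 he =>
      cases he with
      | basicEvt =>
        exact ⟨.running (by simpa using Running.init),
          fun κ' hκ' => Function.update_of_ne hκ' _ _, .inl ⟨nofun, rfl⟩⟩
    | evtSeq2 he => cases he
  | idle =>
    rw [kernelSet] at hst
    cases hst with
    | evtSet hE he =>
      cases he with
      | basicEvt hg =>
        obtain ⟨f, hf, hr⟩ := Running.of_mem_guard hE hg
        rw [hf]
        exact ⟨.running (by simpa using hr),
          fun κ' hκ' => Function.update_of_ne hκ' _ _, .inl ⟨nofun, rfl⟩⟩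
  | done =>
    -- A finished anonymous event has no transition, so this core is stuck. It gets here when the
    -- last step of a body is taken by `evtSeq1` instead of `evtSeq2`.
    cases hst with
    | evtSeq1 he => cases he
    | evtSeq2 he => cases he
  | running hr =>
    cases hst with
    | evtSeq1 he =>
      cases he with
      | anonyEvt hp =>
        obtain ⟨rfl, rfl⟩ := progStep_basic hp
        exact ⟨.done, fun _ _ => rfl, .inr ⟨rfl, _, hr, rfl⟩⟩
    | evtSeq2 he =>
      cases he with
      | anonyEvt hp =>
        obtain ⟨-, rfl⟩ := progStep_basic hp
        exact ⟨.idle, fun _ _ => rfl, .inr ⟨rfl, _, hr, rfl⟩⟩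

/-- The moving core is covered by `CoreInv.step`. The other core keeps its event system, its event
and the current partition of its scheduler, hence its part of the invariant. -/
theorem KernelInv.parStep
    {C C' : PConf (KState Sched Part Chan Msg) (List (Param Port Msg)) Core}
    {δ : Label (KState Sched Part Chan Msg) (List (Param Port Msg)) Core}
    (h : KernelInv conf C) (hst : ParStep C δ C') :
    KernelInv conf C' ∧ ((δ.kind ≠ .cmd ∧ C'.state = C.state) ∨
      (δ.kind = .cmd ∧
        ∃ f, Running conf δ.core C.state (C.ctx δ.core) f ∧ C'.state = f C.state)) := by
  cases hst with
  | @par PS s s' x x' t κ ES' hE =>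
    obtain ⟨h₁, hx, h₂⟩ := CoreInv.step (h κ) hE
    refine ⟨fun κ' => ?_, h₂⟩
    by_cases hκ : κ' = κ
    · subst hκ
      simpa using h₁
    · have hcur : s'.cur (conf.c2s κ') = s.cur (conf.c2s κ') := by
        rcases h₂ with ⟨-, rfl⟩ | ⟨-, f, hr, rfl⟩
        · rfl
        · exact hr.cur_eq hκ
      simpa [Function.update_of_ne hκ, hx κ' hκ] using (h κ').congr_cur hcur

-- Events determine their bodies

/-- The guards differ at the empty parameter list: everything for `Schedule`, nothing for a write.
The state `s` witnesses that these two sets are distinct. -/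
theorem schedule_ne_write (s : KState Sched Part Chan Msg) (ps : List (Param Port Msg)) :
    (.basic (schedule conf) : KEvent Sched Part Port Chan Msg) ≠
      (writeSamplingMessage conf).inst ps := by
  intro h
  simp only [EventSpec.inst, Event.basic.injEq] at h
  have hs : s ∈ ((schedule conf : KSpec Sched Part Port Chan Msg) ([], 0)).1 := trivial
  rw [h] at hs
  exact hs.2

theorem schedule_ne_read (s : KState Sched Part Chan Msg) (ps : List (Param Port Msg)) :
    (.basic (schedule conf) : KEvent Sched Part Port Chan Msg) ≠
      (readSamplingMessage conf).inst ps := by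
  intro h
  simp only [EventSpec.inst, Event.basic.injEq] at h
  have hs : s ∈ ((schedule conf : KSpec Sched Part Port Chan Msg) ([], 0)).1 := trivial
  rw [h] at hs
  exact hs.2

/-- The event determines the parameters of an enabled guard, and hence the body. -/
theorem Running.guard_body {κ : Core} {s : KState Sched Part Chan Msg}
    {e : KEvent Sched Part Port Chan Msg} {f} (h : Running conf κ s e f) :
    ∃ α p, e = .basic α ∧ s ∈ (α (p, κ)).1 ∧ (α (p, κ)).2 = .basic f := by
  cases h with
  | init => exact ⟨_, [], rfl, trivial, rfl⟩
  | schedule => exact ⟨_, [], rfl, trivial, rfl⟩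
  | write h₁ h₂ => exact ⟨_, _, rfl, ⟨rfl, h₁, h₂⟩, rfl⟩
  | read h₁ h₂ => exact ⟨_, _, rfl, ⟨rfl, h₁, h₂⟩, rfl⟩

/-- An enabled guard of a running event admits only the body of the event. -/
theorem Running.eq_of_guard_body {κ : Core} {s t : KState Sched Part Chan Msg}
    {α : KSpec Sched Part Port Chan Msg} {p : List (Param Port Msg)} {f g}
    (h : Running conf κ s (.basic α) f) (ht : t ∈ (α (p, κ)).1)
    (hg : (α (p, κ)).2 = .basic g) : f = g := by
  generalize he : (Event.basic α : KEvent Sched Part Port Chan Msg) = e at h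
  cases h with
  | init =>
    obtain rfl : α = coreInit := by simpa using he
    simpa [coreInit, Prog.skip] using hg
  | schedule =>
    obtain rfl : α = EventIFS.schedule conf := by simpa using he
    match p, ht, hg with
    | [], _, hg => simpa [EventIFS.schedule] using hg
  | write =>
    simp only [EventSpec.inst, Event.basic.injEq] at he
    subst he
    -- The guard of an instantiated event admits only its own parameter list, which fixes `p`.
    obtain ⟨rfl, -⟩ := ht
    simpa [writeSamplingMessage] using hg
  | read =>
    simp only [EventSpec.inst, Event.basic.injEq] at he
    subst he
    obtain ⟨rfl, -⟩ := ht
    simpa [readSamplingMessage, Prog.skip] using hg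

/-- Passing to a guard and body for `hg` leaves one case analysis, on `hf`, instead of a comparison
of all pairs of event kinds. -/
theorem Running.unique {κ : Core} {s t : KState Sched Part Chan Msg}
    {e : KEvent Sched Part Port Chan Msg} {f g} (hf : Running conf κ s e f)
    (hg : Running conf κ t e g) : f = g := by
  obtain ⟨α, p, rfl, ht, hb⟩ := hg.guard_body
  exact hf.eq_of_guard_body ht hb

-- Observations under the state changes

/-- The state enters the choice only through a proof of nonemptiness, and proofs are irrelevant. -/
theorem chosenPart_eq (d : Sched) (s t : KState Sched Part Chan Msg) :
    chosenPart conf d s = chosenPart conf d t := rfl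

theorem chSrcSampPort_spec {po : Port} (h : IsSrcSampPort conf po) :
    conf.scsrc (chSrcSampPort conf po h) = po := h.choose_spec

theorem stateObs_P_eq_iff {s₀ s t : KState Sched Part Chan Msg} {p : Part} :
    stateObs conf s₀ s (.P p) = stateObs conf s₀ t (.P p) ↔
      ∀ ch, PartConnected conf p ch → s.schan ch = t.schan ch := by
  simp only [stateObs, KState.mk.injEq, true_and]
  refine ⟨fun h ch hc => by simpa [schanObsPart, hc] using congrFun h ch, fun h => funext fun ch => ?_⟩
  by_cases hc : PartConnected conf p ch
  · simpa [schanObsPart, hc] using h ch hc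
  · simp [schanObsPart, hc]

theorem stateObs_S_eq_iff {s₀ s t : KState Sched Part Chan Msg} {d : Sched} :
    stateObs conf s₀ s (.S d) = stateObs conf s₀ t (.S d) ↔ s.cur d = t.cur d := by
  simp only [stateObs, KState.mk.injEq, and_true]
  exact ⟨fun h => by simpa using congrFun h d, fun h => by rw [h]⟩

theorem stateObs_scheduleUpd_congr {s₀ s t : KState Sched Part Chan Msg} {κ : Core}
    {u : Domain Sched Part} (h : stateObs conf s₀ s u = stateObs conf s₀ t u) :
    stateObs conf s₀ (scheduleUpd conf κ s) u = stateObs conf s₀ (scheduleUpd conf κ t) u := by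
  cases u with
  | P p => exact h
  | S d =>
    rw [stateObs_S_eq_iff] at h ⊢
    by_cases hd : d = conf.c2s κ
    · subst hd
      simp [scheduleUpd, chosenPart_eq _ s t]
    · simpa [scheduleUpd, hd] using h

theorem stateObs_writeUpd_congr {s₀ s t : KState Sched Part Chan Msg} {po : Port} {m : Msg}
    {u : Domain Sched Part} (h : stateObs conf s₀ s u = stateObs conf s₀ t u) :
    stateObs conf s₀ (writeUpd conf po m s) u = stateObs conf s₀ (writeUpd conf po m t) u := by
  by_cases hpo : IsSrcSampPort conf po
  · cases u with
    | P p =>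
      rw [stateObs_P_eq_iff] at h ⊢
      intro ch hc
      by_cases hch : ch = chSrcSampPort conf po hpo
      · simp [writeUpd, hpo, hch]
      · simpa [writeUpd, hpo, hch] using h ch hc
    | S d =>
      rw [stateObs_S_eq_iff] at h ⊢
      simpa [writeUpd, hpo] using h
  · simpa [writeUpd, hpo] using h

/-- The bodies of the events preserve the equivalence of every domain. -/
theorem Running.stateObs_congr {κ : Core} {s₀ r s t : KState Sched Part Chan Msg}
    {e : KEvent Sched Part Port Chan Msg} {f} (hr : Running conf κ r e f)
    {u : Domain Sched Part} (h : stateObs conf s₀ s u = stateObs conf s₀ t u) :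
    stateObs conf s₀ (f s) u = stateObs conf s₀ (f t) u := by
  cases hr with
  | init => exact h
  | schedule => exact stateObs_scheduleUpd_congr h
  | write => exact stateObs_writeUpd_congr h
  | read => exact h

theorem stateObs_scheduleUpd {s₀ s : KState Sched Part Chan Msg} {κ : Core}
    {u : Domain Sched Part} (h : ¬ kInterf conf (.S (conf.c2s κ)) u) :
    stateObs conf s₀ s u = stateObs conf s₀ (scheduleUpd conf κ s) u := by
  cases u with
  | P p => rfl
  | S d =>
    have hd : d ≠ conf.c2s κ := fun hd => h (Or.inl (by rw [hd]))
    rw [stateObs_S_eq_iff]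
    simp [scheduleUpd, hd]

theorem stateObs_writeUpd {s₀ s : KState Sched Part Chan Msg} {po : Port} {m : Msg}
    {u : Domain Sched Part} (h : ¬ kInterf conf (.P (conf.p2p po)) u) :
    stateObs conf s₀ s u = stateObs conf s₀ (writeUpd conf po m s) u := by
  by_cases hpo : IsSrcSampPort conf po
  · cases u with
    | P p =>
      rw [stateObs_P_eq_iff]
      intro ch hc
      have hch : ch ≠ chSrcSampPort conf po hpo := by
        rintro rfl
        -- If `p` sees the written channel, it owns either the source port, and is then the writer
        -- itself, or a destination port, and the channel then connects the writer to `p`.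
        obtain ⟨po', rfl | hd, rfl⟩ := hc
        · exact h (Or.inl (by rw [chSrcSampPort_spec hpo]))
        · exact h (Or.inr (Or.inr ⟨_, by rw [chSrcSampPort_spec hpo], po', hd, rfl⟩))
      simp [writeUpd, hpo, hch]
    | S d =>
      rw [stateObs_S_eq_iff]
      simp [writeUpd, hpo]
  · simp [writeUpd, hpo]

/-- The body of an event is invisible to the domains the domain of the event does not interfere
with. -/
theorem Running.stateObs_eq {κ : Core} {s₀ s : KState Sched Part Chan Msg}
    {e : KEvent Sched Part Port Chan Msg} {f} (hr : Running conf κ s e f)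
    {u : Domain Sched Part} (h : ¬ kInterf conf (domOfEvt conf s κ e) u) :
    stateObs conf s₀ s u = stateObs conf s₀ (f s) u := by
  cases hr with
  | init => rfl
  | schedule =>
    refine stateObs_scheduleUpd ?_
    rwa [domOfEvt, if_neg] at h
    rintro (⟨ps, hps⟩ | ⟨ps, hps⟩)
    · exact schedule_ne_write s ps hps
    · exact schedule_ne_read s ps hps
  | write _ hpo =>
    refine stateObs_writeUpd ?_
    -- The guard recorded by `Running` identifies the current partition, which is the acting domain,
    -- with the owner of `po`.
    rwa [domOfEvt, if_pos (Or.inl ⟨_, rfl⟩), ← hpo] at h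
  | read => rfl

-- Unwinding conditions for the kernel

variable {s₀ : KState Sched Part Chan Msg}
  {x₀ : EvtCtx (KState Sched Part Chan Msg) (List (Param Port Msg)) Core}

theorem kernelInv_preserves :
    (machine (kernelIFS conf s₀) (XKernel conf) s₀ x₀).Preserves (KernelInv conf) :=
  fun _ _ _ hC hst => (hC.parStep hst.1).1

/-- A step of the kernel either leaves the state unchanged, or is a program action that executes
the body of the event of the action. -/
theorem KernelInv.machine_step
    {C C' : PConf (KState Sched Part Chan Msg) (List (Param Port Msg)) Core}
    {a : Action (KState Sched Part Chan Msg) (List (Param Port Msg)) Core (Domain Sched Part)}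
    (hC : KernelInv conf C)
    (hst : (C, C') ∈ (machine (kernelIFS conf s₀) (XKernel conf) s₀ x₀).step a) :
    (a.label.kind ≠ .cmd ∧ C'.state = C.state) ∨
      (a.label.kind = .cmd ∧ domOfEvt conf C.state a.label.core a.ev = a.dom ∧
        ∃ f, Running conf a.label.core C.state a.ev f ∧ C'.state = f C.state) := by
  obtain ⟨hp, hk⟩ := hst
  rcases (hC.parStep hp).2 with h | ⟨h, hr⟩
  · exact .inl h
  · rcases hk with ⟨hk, -⟩ | ⟨-, hev, hd⟩
    · exact absurd (hk.symm.trans h) nofun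
    · exact .inr ⟨h, hd, hev ▸ hr⟩

theorem kernel_localRespect :
    LocalRespect (kernelIFS conf s₀) (machine (kernelIFS conf s₀) (XKernel conf) s₀ x₀)
      (KernelInv conf) := by
  intro a C C' u hC hst hu
  change stateObs conf s₀ C.state u = stateObs conf s₀ C'.state u
  rcases hC.machine_step hst with ⟨-, h⟩ | ⟨-, hd, f, hr, h⟩
  · rw [h]
  · rw [h]
    exact hr.stateObs_eq (hd ▸ hu)

theorem kernel_stepConsistent :
    StepConsistent (kernelIFS conf s₀) (machine (kernelIFS conf s₀) (XKernel conf) s₀ x₀)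
      (KernelInv conf) := by
  intro a C₁ C₁' C₂ C₂' u h₁ h₂ hst₁ hst₂ he
  change stateObs conf s₀ C₁'.state u = stateObs conf s₀ C₂'.state u
  -- Both steps carry the label of `a`, so both are occurrences or both are program actions; the
  -- mixed cases are contradictory.
  rcases h₁.machine_step hst₁ with ⟨hk, h₁⟩ | ⟨hk, -, f, hf, h₁⟩ <;>
    rcases h₂.machine_step hst₂ with ⟨hk', h₂⟩ | ⟨hk', -, g, hg, h₂⟩
  · rw [h₁, h₂]
    exact he
  · exact absurd hk' hk
  · exact absurd hk hk'
  · rw [h₁, h₂, ← hf.unique hg]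
    exact hf.stateObs_congr he

end KernelProofs

end EventIFS

theorem mainTheorem6 {Sched Part Port Chan Msg : Type*}
    (conf : EventIFS.Config Sched Part Port Chan)
    (s₀ : EventIFS.KState Sched Part Chan Msg)
    (x₀ : EventIFS.Core → EventIFS.KEvent Sched Part Port Chan Msg) :
    EventIFS.Noninfluence (EventIFS.kernelIFS conf s₀) (EventIFS.XKernel conf) s₀ x₀ ∧
      EventIFS.Nonleakage (EventIFS.kernelIFS conf s₀) (EventIFS.XKernel conf) s₀ x₀ := by
  -- The initial event context may be arbitrary, because `CoreInv.start` puts no condition on the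
  -- current event.
  have h₀ : EventIFS.KernelInv conf ⟨EventIFS.XKernel conf, s₀, x₀⟩ := fun _ => .start
  -- Equivalence for a domain is by definition equality of its observations, so `hob` is the
  -- identity.
  exact ⟨EventIFS.noninfluence_of_unwinding (fun _ _ _ h => h) h₀ EventIFS.kernelInv_preserves
      EventIFS.kernel_stepConsistent EventIFS.kernel_localRespect,
    EventIFS.nonleakage_of_unwinding (fun _ _ _ h => h) h₀ EventIFS.kernelInv_preserves
      EventIFS.kernel_stepConsistent⟩
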